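/- **Theorem 1.2 (Entropic independence).** Let $1\le k\le n$, let $b\in(0,1)$, $c\in(0,1]$, $\alpha>0$, and let $\nu$ be a probability measure on the $k$-slice $\binom{[n]}{k}=\{S\subseteq[n]:|S|=k\}$. Let $\widetilde\nu$ be the pushforward of $\nu$ to $\{\pm1\}^n$ under $S\mapsto 2\cdot\mathbf 1_S-\mathbf 1$. For a probability measure $\pi$ on $\{\pm1\}^n$ let $A(\pi)=\{i\in[n]:\mathrm{Var}_\pi(X_i)>0\}$, where $X_i$ is the $i$-th coordinate, and let the influence matrix $\Psi(\pi)$ be the $A(\pi)\times A(\pi)$ matrix $$\Psi(\pi)_{ij}=\frac{\mathrm{Cov}_\pi(X_i,X_j)}{\mathrm{Var}_\pi(X_j)} .$$ For $u\in\{-1,0,1\}^n$ such that the event $E_u=\{X_i=u_i\text{ for all }i\text{ with }u_i\ne0\}$ has positive $\widetilde\nu$-probability (such a $u$ is called feasible), let $\mathcal R_u\widetilde\nu=\widetilde\nu(\,\cdot\mid E_u)$. Suppose that (a) for every $i\in[n]$, either $\mathbb P_{S\sim\nu}[i\in S]=0$ or $\mathbb P_{S\sim\nu}[i\in S]\ge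 b$; and (b) $\|\Psi(\mathcal R_u\widetilde\nu)\|_{\mathrm{op}}\le\alpha$ (the $\ell_2\to\ell_2$ operator norm) for every feasible $u\in\{-1,0,1\}^n$ with at most $\lceil cn\rceil$ nonzero coordinates. Then $\nu$ is $C$-entropically independent with $C=2\alpha/(bc)$: for every probability measure $\mu\ll\nu$ on $\binom{[n]}{k}$, $$\mathrm{KL}(q_\mu\,\|\,q_\nu)\le\frac{C}{k}\,\mathrm{KL}(\mu\,\|\,\nu),$$ where $q_\mu$ is the probability distribution on $[n]$ given by $q_\mu(i)=\mathbb P_{S\sim\mu}[i\in S]/k$, and likewise $q_\nu$. -/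

import Mathlib

open MeasureTheory ProbabilityTheory InformationTheory
open scoped ENNReal

/-- The `k`-slice: the `k`-element subsets of `[n]`. -/
abbrev Slice (n k : ℕ) : Type := {S : Finset (Fin n) // S.card = k}

/-- The discrete cube `{±1}^n`. -/
abbrev SignCube (n : ℕ) : Type := Fin n → ℤˣ

/-- The signs `±1` carry the discrete `σ`-algebra, hence so does the cube. -/
instance : MeasurableSingletonClass ℤˣ where
  measurableSet_singleton a :=
    ⟨{(a : ℤ)}, measurableSet_singleton _, by ext x; simp [Units.ext_iff]⟩

/-- The coordinate `X_i`, as a real random variable on the cube. -/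
def coord {n : ℕ} (i : Fin n) (x : SignCube n) : ℝ := ((x i : ℤ) : ℝ)

/-- The law `q_μ(i) = P_{S ∼ μ}[i ∈ S] / k` of the normalized one-site marginals, as a measure
on `[n]`. -/
noncomputable def siteLaw {n k : ℕ} (μ : Measure (Slice n k)) : Measure (Fin n) :=
  (k : ℝ≥0∞)⁻¹ • ∑ i : Fin n, μ {S | i ∈ S.1} • Measure.dirac i

/-- `C`-entropic independence: `KL(q_μ ‖ q_ν) ≤ (C / k) KL(μ ‖ ν)` for every probability measure
`μ ≪ ν` on the slice (an inequality in `[0, ∞]`). -/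
def EntropicallyIndependent {n k : ℕ} (C : ℝ) (ν : Measure (Slice n k)) : Prop :=
  ∀ (μ : Measure (Slice n k)) [IsProbabilityMeasure μ], μ ≪ ν →
    klDiv (siteLaw μ) (siteLaw ν) ≤ ENNReal.ofReal (C / k) * klDiv μ ν

/-- The embedding of the slice into the cube, `S ↦ 2 · 1_S - 1`. -/
def sliceToCube {n k : ℕ} (S : Slice n k) : SignCube n :=
  fun i => if i ∈ S.1 then 1 else -1

/-- The event that `X_i = u_i` for all `i` with `u_i ≠ 0`. -/
def pinEvent {n : ℕ} (u : Fin n → SignType) : Set (SignCube n) :=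
  {x | ∀ i, u i ≠ 0 → (x i : ℤ) = (u i : ℤ)}

/-- The pinning `R_u ν`: the measure `ν` conditioned on `pinEvent u`. -/
noncomputable def pin {n : ℕ} (u : Fin n → SignType) (ν : Measure (SignCube n)) :
    Measure (SignCube n) :=
  cond ν (pinEvent u)

/-- A pinning is feasible for `ν` if the conditioning event has positive probability. -/
def Feasible {n : ℕ} (u : Fin n → SignType) (ν : Measure (SignCube n)) : Prop :=
  0 < ν (pinEvent u)

open Classical in
/-- The active coordinates of `ν`: those of positive variance. -/
noncomputable def activeCoords {n : ℕ} (ν : Measure (SignCube n)) : Finset (Fin n) :=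
  Finset.univ.filter fun i => 0 < Var[coord i; ν]

/-- The influence matrix `Ψ(ν) = Cov(ν) · diag(Var_ν(X_i))⁻¹`, on the active coordinates. -/
noncomputable def influenceMatrix {n : ℕ} (ν : Measure (SignCube n)) :
    Matrix (activeCoords ν) (activeCoords ν) ℝ :=
  Matrix.of fun i j => cov[coord i.1, coord j.1; ν] / Var[coord j.1; ν]

/-- The operator norm of a real square matrix with respect to the Euclidean norm. -/
noncomputable def l2OpNorm {ι : Type*} [Fintype ι] [DecidableEq ι] (A : Matrix ι ι ℝ) : ℝ :=
  ‖Matrix.toEuclideanCLM (n := ι) (𝕜 := ℝ) A‖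

/-- `sign(V)`: the downward closure of the set of sign vectors of the elements of `V`. -/
def signSet {n : ℕ} (V : Set (Fin n → ℝ)) : Set (Fin n → SignType) :=
  {s | ∃ v ∈ V, ∀ i, s i = 0 ∨ s i = SignType.sign (v i)}

/-- `Sparse_c`: the vectors with at most `⌈c n⌉` nonzero coordinates. -/
def sparseVectors (n : ℕ) (c : ℝ) : Set (Fin n → ℝ) :=
  {v | {i | v i ≠ 0}.ncard ≤ ⌈c * n⌉₊}

/-- `ν` is `α`-`ℓ₂`-independent restricted to `𝒮`: the influence matrix of every feasible pinning
of `ν` by an element of `𝒮` has operator norm at most `α`. -/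
def L2IndependentOn {n : ℕ} (α : ℝ) (𝒮 : Set (Fin n → SignType)) (ν : Measure (SignCube n)) :
    Prop :=
  ∀ u ∈ 𝒮, Feasible u ν → l2OpNorm (influenceMatrix (pin u ν)) ≤ α

/-!
Write `p_μ(i) = P_μ[i ∈ S]` and `d = p_μ - p_ν`. Bounding relative entropy by the `χ²`-divergence
(`klDiv_le_sum_sq_div`) and using that the positive marginals of `ν` are at least `b`, one gets
`KL(q_μ ‖ q_ν) ≤ ‖d‖² / (b k)`. Some set `T` of `⌈c n⌉` coordinates carries at least the fraction
`c` of `‖d‖²` (`exists_subset_card_eq_mul_sum_le`), so it suffices that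
`∑_{i ∈ T} d_i² ≤ 2 α KL(μ ‖ ν)` (`sum_sq_marginal_sub_le`). By the Gibbs variational principle
(`integral_sub_log_integral_exp_le_toReal_klDiv`) this follows from a sub-Gaussian bound for
linear statistics supported on `T` (`log_integral_exp_agreeWeight_le`): for signs `σ`, weights
`a ≥ 0` on `T`, and `g = ∑_{i ∈ T} a_i 1[X_i = σ_i]`,
`log E e^{t g} ≤ t E g + α ‖a‖² t² / 2`.

The sub-Gaussian bound uses only pinnings of subsets of `T` to the signs `σ`, which are exactly the
pinnings by elements of `sign(Sparse_c)`. Let `Z_U(t) = E[1{X_U = σ_U} e^{t g}]` for `U ⊆ T`. As the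
indicators are idempotent, these functions satisfy the closed linear system
`Z_U' = ∑_{i ∈ T} a_i Z_{U ∪ {i}}`, and so do the derivatives `N_U = Z_U'`. Let `M_U` be the mean of
`g` under the measure pinned on `U`, and let `R_U(t) = Z_U(t) (M_U + κ t) - N_U(t)` with
`κ = α ‖a‖²`. Then `R_U(0) = 0` and
`R_U' = ∑_i a_i R_{U ∪ {i}} + κ Z_U - ∑_i a_i Z_{U ∪ {i}} (M_{U ∪ {i}} - M_U)`.
The jump `M_{U ∪ {i}} - M_U` is given by a column of the influence matrix of the measure pinned
on `U`, so the operator norm bound makes the last sum at most `κ Z_U` (`sum_jump_le`). Downward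
induction on `U` gives `R_U ≥ 0` (`hierarchy_deriv_le`), and at `U = ∅` this says
`(log Z_∅)' ≤ M_∅ + κ t`, which integrates to the claim (`log_le_of_hierarchy`).
-/

/-! ### A hierarchy of linear differential inequalities -/

lemma nonneg_of_deriv_ge_mul {R R' : ℝ → ℝ} {A : ℝ} (hR : ∀ t, HasDerivAt R (R' t) t)
    (h0 : R 0 = 0) (hR' : ∀ t, 0 ≤ t → A * R t ≤ R' t) {t : ℝ} (ht : 0 ≤ t) : 0 ≤ R t := by
  have hd : ∀ t, HasDerivAt (fun s => Real.exp (-(A * s)) * R s)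
      (Real.exp (-(A * t)) * (R' t - A * R t)) t := fun t => by
    have h := ((((hasDerivAt_id t).const_mul A).neg).exp).mul (hR t)
    refine h.congr_deriv ?_
    simp only [id, mul_one, Pi.neg_apply]
    ring
  have hmono : MonotoneOn (fun s => Real.exp (-(A * s)) * R s) (Set.Ici 0) := by
    refine monotoneOn_of_deriv_nonneg (convex_Ici 0)
      (fun t _ => (hd t).continuousAt.continuousWithinAt)
      (fun t _ => (hd t).differentiableAt.differentiableWithinAt) fun t ht' => ?_
    rw [interior_Ici] at ht'
    rw [(hd t).deriv]
    exact mul_nonneg (Real.exp_pos _).le (sub_nonneg.2 (hR' t (le_of_lt ht')))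
  have := hmono (Set.mem_Ici.2 le_rfl) (Set.mem_Ici.2 ht) ht
  simp only [h0, mul_zero] at this
  exact nonneg_of_mul_nonneg_right this (Real.exp_pos _)

section Hierarchy

variable {ι : Type*} [DecidableEq ι] {Z : Finset ι → ℝ → ℝ} {T : Finset ι} {a : ι → ℝ} {κ : ℝ}

/-- Suppose `Z_U' = ∑_{i ∈ T} a_i Z_{U ∪ {i}}` with `Z_U ≥ 0` decreasing in `U`. If at time `0`
every weighted sum of the jumps of the logarithmic derivative `Z_U' / Z_U` from `U` to `U ∪ {i}`,
with weights `a_i θ_i` and `θ_i ∈ [0, 1]`, is at most `κ`, then the logarithmic derivative grows at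
rate at most `κ`. -/
lemma hierarchy_deriv_le (ha : ∀ i, 0 ≤ a i) (hZ : ∀ U t, 0 ≤ Z U t)
    (hmono : ∀ U i t, Z (insert i U) t ≤ Z U t)
    (hzero : ∀ U t, Z U 0 = 0 → Z U t = 0)
    (hpos : ∀ U t, 0 < Z U 0 → 0 < Z U t)
    (hderiv : ∀ U t, HasDerivAt (Z U) (∑ i ∈ T, a i * Z (insert i U) t) t)
    (hκ : ∀ U ⊆ T, 0 < Z U 0 → ∀ θ : ι → ℝ, (∀ i, 0 ≤ θ i ∧ θ i ≤ 1) →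
      (∀ i, Z (insert i U) 0 = 0 → θ i = 0) →
      ∑ i ∈ T, a i * θ i * ((∑ j ∈ T, a j * Z (insert j (insert i U)) 0) / Z (insert i U) 0
        - (∑ j ∈ T, a j * Z (insert j U) 0) / Z U 0) ≤ κ)
    {U : Finset ι} (hU : U ⊆ T) {t : ℝ} (ht : 0 ≤ t) :
    ∑ i ∈ T, a i * Z (insert i U) t ≤
      Z U t * ((∑ i ∈ T, a i * Z (insert i U) 0) / Z U 0 + κ * t) := by
  set N : Finset ι → ℝ → ℝ := fun U t => ∑ i ∈ T, a i * Z (insert i U) t with hN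
  set M : Finset ι → ℝ := fun U => N U 0 / Z U 0 with hM
  -- the terms `i ∈ U` of the system reproduce `U` itself, the others enlarge it: induct on `T \ U`
  suffices H : ∀ m : ℕ, ∀ U ⊆ T, (T \ U).card = m → ∀ t, 0 ≤ t →
      0 ≤ Z U t * (M U + κ * t) - N U t from sub_nonneg.1 (H _ U hU rfl t ht)
  clear hU ht t U
  intro m
  induction m using Nat.strong_induction_on with
  | _ m IH =>
  intro U hU hm t ht
  -- if `Z U 0 = 0` then `M U` is a junk quotient, but everything it multiplies vanishes
  rcases (hZ U 0).eq_or_lt with h0 | h0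
  · have hN0 : N U t = 0 := Finset.sum_eq_zero fun i _ => by
      have : Z (insert i U) t = 0 :=
        le_antisymm ((hmono U i t).trans (hzero U t h0.symm).le) (hZ _ _)
      rw [this, mul_zero]
    rw [hzero U t h0.symm, hN0]
    simp
  have hNd : ∀ t, HasDerivAt (N U) (∑ i ∈ T, a i * N (insert i U) t) t := fun t =>
    HasDerivAt.fun_sum fun i _ => (hderiv (insert i U) t).const_mul (a i)
  have hRd : ∀ t, HasDerivAt (fun t => Z U t * (M U + κ * t) - N U t)
      (N U t * (M U + κ * t) + Z U t * κ - ∑ i ∈ T, a i * N (insert i U) t) t := fun t => by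
    have h := ((hderiv U t).mul (((hasDerivAt_id t).const_mul κ).const_add (M U))).sub (hNd t)
    refine h.congr_deriv ?_
    simp [hN]
  refine nonneg_of_deriv_ge_mul (A := ∑ i ∈ U, a i) hRd ?_ ?_ ht
  · simp only [hM, mul_zero, add_zero]
    rw [mul_div_cancel₀ _ h0.ne', sub_self]
  intro t ht
  have hZt := hpos U t h0
  -- `hκ` for the ratios `θ_i = Z_{U ∪ {i}}(t) / Z_U(t)`, which monotonicity puts in `[0, 1]`
  have hjump : ∑ i ∈ T, a i * Z (insert i U) t * (M (insert i U) - M U) ≤ Z U t * κ := by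
    have h := hκ U hU h0 (fun i => Z (insert i U) t / Z U t)
      (fun i => ⟨div_nonneg (hZ _ _) hZt.le, (div_le_one hZt).2 (hmono U i t)⟩)
      (fun i hi => by simp [hzero _ t hi])
    have h' := mul_le_mul_of_nonneg_left h hZt.le
    refine le_trans (le_of_eq ?_) h'
    rw [Finset.mul_sum]
    refine Finset.sum_congr rfl fun i _ => ?_
    simp only [hM, hN]
    field_simp
  have hself : (∑ i ∈ U, a i) * (Z U t * (M U + κ * t) - N U t) ≤
      ∑ i ∈ T, a i * (Z (insert i U) t * (M (insert i U) + κ * t) - N (insert i U) t) := by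
    rw [Finset.sum_mul, ← Finset.sum_sdiff hU]
    have h1 : ∑ i ∈ U, a i * (Z (insert i U) t * (M (insert i U) + κ * t) - N (insert i U) t)
        = ∑ i ∈ U, a i * (Z U t * (M U + κ * t) - N U t) :=
      Finset.sum_congr rfl fun i hi => by rw [Finset.insert_eq_of_mem hi]
    rw [h1]
    refine le_add_of_nonneg_left (Finset.sum_nonneg fun i hi => mul_nonneg (ha i) ?_)
    have hiT := (Finset.mem_sdiff.1 hi).1
    refine IH _ ?_ (insert i U) (Finset.insert_subset hiT hU) rfl t ht
    rw [← hm]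
    refine Finset.card_lt_card ⟨Finset.sdiff_subset_sdiff le_rfl (Finset.subset_insert i U), ?_⟩
    intro hsub
    have := hsub hi
    simp at this
  refine hself.trans ?_
  have hexp : ∑ i ∈ T, a i * (Z (insert i U) t * (M (insert i U) + κ * t) - N (insert i U) t)
      = ∑ i ∈ T, a i * Z (insert i U) t * (M (insert i U) - M U)
        + N U t * (M U + κ * t) - ∑ i ∈ T, a i * N (insert i U) t := by
    simp only [hN, Finset.sum_mul]
    rw [← Finset.sum_add_distrib, ← Finset.sum_sub_distrib]
    refine Finset.sum_congr rfl fun i _ => ?_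
    ring
  linarith

/-- The bound of `hierarchy_deriv_le` at `U = ∅`, integrated in time. -/
lemma log_le_of_hierarchy (ha : ∀ i, 0 ≤ a i) (hZ : ∀ U t, 0 ≤ Z U t)
    (hmono : ∀ U i t, Z (insert i U) t ≤ Z U t)
    (hzero : ∀ U t, Z U 0 = 0 → Z U t = 0)
    (hpos : ∀ U t, 0 < Z U 0 → 0 < Z U t)
    (hderiv : ∀ U t, HasDerivAt (Z U) (∑ i ∈ T, a i * Z (insert i U) t) t)
    (hκ : ∀ U ⊆ T, 0 < Z U 0 → ∀ θ : ι → ℝ, (∀ i, 0 ≤ θ i ∧ θ i ≤ 1) →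
      (∀ i, Z (insert i U) 0 = 0 → θ i = 0) →
      ∑ i ∈ T, a i * θ i * ((∑ j ∈ T, a j * Z (insert j (insert i U)) 0) / Z (insert i U) 0
        - (∑ j ∈ T, a j * Z (insert j U) 0) / Z U 0) ≤ κ)
    (h1 : Z ∅ 0 = 1) {t : ℝ} (ht : 0 ≤ t) :
    Real.log (Z ∅ t) ≤ t * (∑ i ∈ T, a i * Z {i} 0) + κ * t ^ 2 / 2 := by
  set m := ∑ i ∈ T, a i * Z {i} 0 with hm
  have hZp : ∀ t, 0 < Z ∅ t := fun t => hpos ∅ t (by rw [h1]; exact one_pos)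
  have hd : ∀ t, HasDerivAt (fun s => s * m + κ * s ^ 2 / 2 - Real.log (Z ∅ s))
      (m + κ * t - (∑ i ∈ T, a i * Z (insert i ∅) t) / Z ∅ t) t := fun t => by
    have h := (((hasDerivAt_id t).mul_const m).add
      ((((hasDerivAt_pow 2 t).const_mul κ)).div_const 2)).sub ((hderiv ∅ t).log (hZp t).ne')
    refine h.congr_deriv ?_
    simp
    ring
  have := nonneg_of_deriv_ge_mul (A := 0) hd (by simp [h1]) (fun t ht => ?_) ht
  · linarith
  rw [zero_mul, sub_nonneg, div_le_iff₀ (hZp t)]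
  have h := hierarchy_deriv_le ha hZ hmono hzero hpos hderiv hκ (Finset.empty_subset T) ht
  rw [h1, div_one] at h
  rw [mul_comm]
  exact h

end Hierarchy

/-! ### Covariances and the influence matrix on the cube -/

lemma covariance_eq_zero_of_variance_eq_zero_left {Ω : Type*} [MeasurableSpace Ω]
    {μ : Measure Ω} [IsFiniteMeasure μ] {X Y : Ω → ℝ} (hX : MemLp X 2 μ) (h : Var[X; μ] = 0) :
    cov[X, Y; μ] = 0 := by
  have hae : ∀ᵐ ω ∂μ, (X ω - μ[X]) * (Y ω - μ[Y]) = 0 := by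
    have h0 : ∫ ω, (X ω - μ[X]) ^ 2 ∂μ = 0 := by
      rw [← variance_eq_integral hX.aemeasurable, h]
    have hsq : Integrable (fun ω => (X ω - μ[X]) ^ 2) μ := (hX.sub (memLp_const _)).integrable_sq
    rw [integral_eq_zero_iff_of_nonneg (fun ω => sq_nonneg _) hsq] at h0
    filter_upwards [h0] with ω hω
    have : X ω - μ[X] = 0 := by simpa using hω
    rw [this, zero_mul]
  rw [covariance, integral_congr_ae hae, integral_zero]

/-- The bilinear form of the influence matrix, summed over all coordinates: the inactive ones
contribute nothing, since there the covariances vanish and division by a zero variance gives `0`. -/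
lemma bilin_influenceMatrix_le {n : ℕ} (ρ : Measure (SignCube n)) [IsProbabilityMeasure ρ]
    {α : ℝ} (hα : l2OpNorm (influenceMatrix ρ) ≤ α) (w z : Fin n → ℝ) (hz : ∀ i, |z i| ≤ |w i|) :
    ∑ i, z i * ∑ j, w j * (cov[coord j, coord i; ρ] / Var[coord i; ρ]) ≤ α * ∑ i, w i ^ 2 := by
  classical
  have hin : ∀ i, i ∉ activeCoords ρ → Var[coord i; ρ] = 0 := fun i hi => by
    simp only [activeCoords, Finset.mem_filter, Finset.mem_univ, true_and, not_lt] at hi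
    exact le_antisymm hi (variance_nonneg _ _)
  set A := activeCoords ρ
  let w' : EuclideanSpace ℝ A := WithLp.toLp 2 fun i => w i
  let z' : EuclideanSpace ℝ A := WithLp.toLp 2 fun i => z i
  have hsum : ∑ i, z i * ∑ j, w j * (cov[coord j, coord i; ρ] / Var[coord i; ρ])
      = inner ℝ w' (Matrix.toEuclideanCLM (𝕜 := ℝ) (influenceMatrix ρ) z') := by
    rw [Matrix.inner_toEuclideanCLM]
    simp only [dotProduct, Matrix.mulVec, influenceMatrix, Matrix.of_apply, Finset.mul_sum, w', z']
    rw [Finset.sum_comm]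
    refine Eq.trans ?_ (Finset.sum_coe_sort A (fun j => ∑ i : A, w j *
      (cov[coord j, coord i.1; ρ] / Var[coord i.1; ρ] * z i.1))).symm
    rw [← Finset.sum_subset (Finset.subset_univ A)]
    · refine Finset.sum_congr rfl fun j hj => ?_
      refine Eq.trans ?_ (Finset.sum_coe_sort A (fun i => w j *
        (cov[coord j, coord i; ρ] / Var[coord i; ρ] * z i))).symm
      rw [← Finset.sum_subset (Finset.subset_univ A)]
      · exact Finset.sum_congr rfl fun i _ => by ring
      · intro i _ hi
        rw [hin i hi]
        simp
    · intro j _ hj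
      refine Finset.sum_eq_zero fun i _ => ?_
      rw [covariance_eq_zero_of_variance_eq_zero_left MemLp.of_discrete (hin j hj)]
      simp
  have hnorm : ∀ v : Fin n → ℝ,
      ‖(WithLp.toLp 2 fun i : A => v i : EuclideanSpace ℝ A)‖ ^ 2 ≤ ∑ i, v i ^ 2 := fun v => by
    rw [EuclideanSpace.real_norm_sq_eq]
    simp only
    refine (Finset.sum_coe_sort A (fun i => v i ^ 2)).le.trans ?_
    exact Finset.sum_le_sum_of_subset_of_nonneg (Finset.subset_univ _) fun _ _ _ => sq_nonneg _
  have hzw : ‖z'‖ ^ 2 ≤ ∑ i, w i ^ 2 :=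
    (hnorm z).trans (Finset.sum_le_sum fun i _ => sq_le_sq.2 (hz i))
  have hα0 : 0 ≤ α := (norm_nonneg _).trans hα
  rw [hsum]
  calc _ ≤ ‖w'‖ * ‖Matrix.toEuclideanCLM (𝕜 := ℝ) (influenceMatrix ρ) z'‖ := real_inner_le_norm _ _
    _ ≤ ‖w'‖ * (α * ‖z'‖) := by
      gcongr
      exact (ContinuousLinearMap.le_opNorm _ _).trans (by gcongr; exact hα)
    _ = α * (‖w'‖ * ‖z'‖) := by ring
    _ ≤ α * ∑ i, w i ^ 2 := by
      gcongr
      nlinarith [two_mul_le_add_sq ‖w'‖ ‖z'‖, hnorm w, hzw]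

lemma Int.units_cast_mul_self (s : ℤˣ) : ((s : ℤ) : ℝ) * ((s : ℤ) : ℝ) = 1 := by
  rcases Int.units_eq_one_or s with h | h <;> simp [h]

lemma coord_eq {n : ℕ} (i : Fin n) (s : ℤˣ) (x : SignCube n) :
    coord i x = ((s : ℤ) : ℝ) * (2 * {x : SignCube n | x i = s}.indicator 1 x - 1) := by
  rcases Int.units_eq_one_or s with h | h <;> rcases Int.units_eq_one_or (x i) with h' | h' <;>
    simp [h, h', coord, Set.indicator, show (-1 : ℤˣ) ≠ 1 by decide,
      show (1 : ℤˣ) ≠ -1 by decide] <;>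
    norm_num

lemma covariance_coord {n : ℕ} (ρ : Measure (SignCube n)) [IsProbabilityMeasure ρ]
    (i j : Fin n) (s t : ℤˣ) :
    cov[coord i, coord j; ρ] = 4 * (((s : ℤ) : ℝ) * ((t : ℤ) : ℝ)) *
      (ρ.real ({x | x i = s} ∩ {x | x j = t}) - ρ.real {x | x i = s} * ρ.real {x | x j = t}) := by
  have hint : ∀ B : Set (SignCube n), ∫ x, B.indicator (1 : SignCube n → ℝ) x ∂ρ = ρ.real B :=
    fun B => integral_indicator_one (Set.toFinite B).measurableSet
  have hi : coord i = fun x => ((s : ℤ) : ℝ) * (2 * {x : SignCube n | x i = s}.indicator 1 x - 1) :=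
    funext (coord_eq i s)
  have hj : coord j = fun x => ((t : ℤ) : ℝ) * (2 * {x : SignCube n | x j = t}.indicator 1 x - 1) :=
    funext (coord_eq j t)
  rw [hi, hj, covariance_const_mul_left, covariance_const_mul_right,
    covariance_sub_const_left Integrable.of_finite, covariance_sub_const_right Integrable.of_finite,
    covariance_const_mul_left, covariance_const_mul_right,
    covariance_eq_sub MemLp.of_discrete MemLp.of_discrete]
  rw [← Set.inter_indicator_one, hint, hint, hint]
  ring

lemma variance_coord {n : ℕ} (ρ : Measure (SignCube n)) [IsProbabilityMeasure ρ]
    (i : Fin n) (s : ℤˣ) :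
    Var[coord i; ρ] = 4 * (ρ.real {x | x i = s} * (1 - ρ.real {x | x i = s})) := by
  rw [← covariance_self (measurable_of_finite _).aemeasurable, covariance_coord ρ i i s s,
    Set.inter_self, Int.units_cast_mul_self]
  ring

/-- Conditioning on `X_i = s` shifts the probability of `X_j = t` by an entry of the influence
matrix, up to signs and the factor `P(X_i ≠ s)`. -/
lemma real_inter_div_sub {n : ℕ} (ρ : Measure (SignCube n)) [IsProbabilityMeasure ρ]
    (i j : Fin n) (s t : ℤˣ) (hi : ρ.real {x | x i = s} ≠ 0) :
    ρ.real ({x | x j = t} ∩ {x | x i = s}) / ρ.real {x | x i = s} - ρ.real {x | x j = t} =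
      ((t : ℤ) : ℝ) * ((s : ℤ) : ℝ) * (1 - ρ.real {x | x i = s}) *
        (cov[coord j, coord i; ρ] / Var[coord i; ρ]) := by
  have hs := Int.units_cast_mul_self s
  have ht := Int.units_cast_mul_self t
  have hcov := covariance_coord ρ j i t s
  have hvar := variance_coord ρ i s
  set P := ρ.real {x | x i = s}
  -- if `X_i = s` almost surely, the quotient by the zero variance is junk, but both sides vanish
  by_cases h1 : 1 - P = 0
  · have h0 : cov[coord j, coord i; ρ] = 0 := by
      rw [covariance_comm]
      exact covariance_eq_zero_of_variance_eq_zero_left MemLp.of_discrete (by rw [hvar, h1]; ring)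
    rw [h0] at hcov
    have hne : 4 * (((t : ℤ) : ℝ) * ((s : ℤ) : ℝ)) ≠ 0 := by
      intro h
      have : (((t : ℤ) : ℝ) * ((t : ℤ) : ℝ)) * (((s : ℤ) : ℝ) * ((s : ℤ) : ℝ)) = 0 := by
        linear_combination (((t : ℤ) : ℝ) * ((s : ℤ) : ℝ)) * h / 4
      rw [hs, ht] at this
      norm_num at this
    have := (mul_eq_zero.1 hcov.symm).resolve_left hne
    rw [h1, sub_eq_zero.1 this]
    field_simp
    ring
  · rw [hcov, hvar]
    field_simp
    linear_combination -(ρ.real ({x | x j = t} ∩ {x | x i = s}) - ρ.real {x | x j = t} * P) *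
      ((((t : ℤ) : ℝ) * ((t : ℤ) : ℝ)) * hs + ht)

/-! ### Exponential moments of sparse linear statistics -/

section Laplace

variable {n : ℕ} (π : Measure (SignCube n)) (σ : Fin n → ℤˣ) (a : Fin n → ℝ) (T : Finset (Fin n))

/-- The event that `X` agrees with the sign vector `σ` on `U`. -/
def agreeEvent (U : Finset (Fin n)) : Set (SignCube n) := {x | ∀ i ∈ U, x i = σ i}

/-- The linear statistic `∑_{i ∈ T} a_i 1[X_i = σ_i]`. -/
noncomputable def agreeWeight (x : SignCube n) : ℝ := ∑ i ∈ T, a i * if x i = σ i then 1 else 0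

/-- The Laplace transform `t ↦ E[1{X_U = σ_U} e^{t g}]` of `g = agreeWeight σ a T` on the event
`agreeEvent σ U`, written as a sum over the points of the cube. -/
noncomputable def pinnedLaplace (U : Finset (Fin n)) (t : ℝ) : ℝ :=
  ∑ x, if ∀ i ∈ U, x i = σ i then π.real {x} * Real.exp (t * agreeWeight σ a T x) else 0

/-- The pinning of the coordinates in `U` to the signs `σ`, with `0` marking free coordinates. -/
noncomputable def agreePin (U : Finset (Fin n)) : Fin n → SignType :=
  fun i => if i ∈ U then SignType.sign (σ i : ℤ) else 0

lemma pinEvent_agreePin (U : Finset (Fin n)) :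
    pinEvent (agreePin σ U) = agreeEvent σ U := by
  ext x
  refine forall_congr' fun i => ?_
  by_cases hi : i ∈ U <;>
    rcases Int.units_eq_one_or (σ i) with h | h <;> rcases Int.units_eq_one_or (x i) with h' | h' <;>
    simp [agreePin, hi, h, h', show (-1 : ℤˣ) ≠ 1 by decide, show (1 : ℤˣ) ≠ -1 by decide]

lemma agreePin_mem_signSet {c : ℝ} (hT : T.card ≤ ⌈c * n⌉₊) {U : Finset (Fin n)} (hU : U ⊆ T) :
    agreePin σ U ∈ signSet (sparseVectors n c) := by
  refine ⟨fun i => if i ∈ T then ((σ i : ℤ) : ℝ) else 0, ?_, fun i => ?_⟩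
  · refine le_trans ?_ hT
    rw [← Set.ncard_coe_finset]
    refine Set.ncard_le_ncard (fun i hi => ?_) (Finset.finite_toSet T)
    by_contra h
    exact hi (if_neg h)
  · by_cases hi : i ∈ U
    · right
      rcases Int.units_eq_one_or (σ i) with h | h <;> simp [agreePin, hi, hU hi, h]
    · simp [agreePin, hi]

variable {π}

lemma pinnedLaplace_nonneg (U : Finset (Fin n)) (t : ℝ) : 0 ≤ pinnedLaplace π σ a T U t :=
  Finset.sum_nonneg fun x _ => by split_ifs <;> positivity

lemma pinnedLaplace_insert_le (U : Finset (Fin n)) (i : Fin n) (t : ℝ) :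
    pinnedLaplace π σ a T (insert i U) t ≤ pinnedLaplace π σ a T U t := by
  refine Finset.sum_le_sum fun x _ => ?_
  by_cases h : ∀ j ∈ insert i U, x j = σ j
  · rw [if_pos h, if_pos fun j hj => h j (Finset.mem_insert_of_mem hj)]
  · rw [if_neg h]
    split_ifs <;> positivity

lemma pinnedLaplace_eq_zero {U : Finset (Fin n)} (t : ℝ) (h : pinnedLaplace π σ a T U 0 = 0) :
    pinnedLaplace π σ a T U t = 0 := by
  unfold pinnedLaplace at h ⊢
  rw [Finset.sum_eq_zero_iff_of_nonneg fun x _ => by split_ifs <;> positivity] at h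
  refine Finset.sum_eq_zero fun x hx => ?_
  have := h x hx
  split_ifs at this ⊢ with hc
  · simp only [zero_mul, Real.exp_zero, mul_one] at this
    rw [this, zero_mul]
  · rfl

lemma pinnedLaplace_pos {U : Finset (Fin n)} (t : ℝ) (h : 0 < pinnedLaplace π σ a T U 0) :
    0 < pinnedLaplace π σ a T U t := by
  refine (pinnedLaplace_nonneg σ a T U t).lt_of_ne fun h0 => h.ne' ?_
  unfold pinnedLaplace at h0 ⊢
  rw [eq_comm, Finset.sum_eq_zero_iff_of_nonneg fun x _ => by split_ifs <;> positivity] at h0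
  refine Finset.sum_eq_zero fun x hx => ?_
  have := h0 x hx
  split_ifs at this ⊢ with hc
  · rw [(mul_eq_zero.1 this).resolve_right (Real.exp_pos _).ne', zero_mul]
  · rfl

/-- Differentiation brings down a factor `∑ a_i 1[X_i = σ_i]`, and each indicator merges with that
of the event, enlarging `U` by `i`. -/
lemma hasDerivAt_pinnedLaplace (U : Finset (Fin n)) (t : ℝ) :
    HasDerivAt (pinnedLaplace π σ a T U)
      (∑ i ∈ T, a i * pinnedLaplace π σ a T (insert i U) t) t := by
  have h : HasDerivAt (pinnedLaplace π σ a T U) (∑ x, if ∀ i ∈ U, x i = σ i then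
      π.real {x} * (Real.exp (t * agreeWeight σ a T x) * agreeWeight σ a T x) else 0) t := by
    refine HasDerivAt.fun_sum fun x _ => ?_
    split_ifs
    · refine HasDerivAt.const_mul _ ?_
      simpa using ((hasDerivAt_id t).mul_const (agreeWeight σ a T x)).exp
    · exact hasDerivAt_const t 0
  refine h.congr_deriv ?_
  simp only [pinnedLaplace, Finset.mul_sum]
  rw [Finset.sum_comm]
  refine Finset.sum_congr rfl fun x _ => ?_
  split_ifs with hU
  · rw [← mul_assoc]
    conv_lhs => arg 2; rw [agreeWeight]
    rw [Finset.mul_sum]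
    refine Finset.sum_congr rfl fun i _ => ?_
    by_cases hi : x i = σ i
    · rw [if_pos hi, if_pos ((Finset.forall_mem_insert i U fun j => x j = σ j).2 ⟨hi, hU⟩)]
      ring
    · rw [if_neg hi, if_neg fun h => hi (h i (Finset.mem_insert_self i U))]
      ring
  · refine (Finset.sum_eq_zero fun i _ => ?_).symm
    rw [if_neg fun h => hU fun j hj => h j (Finset.mem_insert_of_mem hj), mul_zero]

lemma agreeEvent_insert (U : Finset (Fin n)) (i : Fin n) :
    agreeEvent σ (insert i U) = agreeEvent σ U ∩ {x | x i = σ i} := by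
  ext x
  simp [agreeEvent, and_comm]

lemma pin_agreePin_real (U : Finset (Fin n)) (B : Set (SignCube n)) :
    (pin (agreePin σ U) π).real B = π.real (agreeEvent σ U ∩ B) / π.real (agreeEvent σ U) := by
  rw [pin, pinEvent_agreePin, measureReal_def, cond_apply (Set.toFinite _).measurableSet,
    ENNReal.toReal_mul, ENNReal.toReal_inv, div_eq_inv_mul, measureReal_def, measureReal_def]

variable [IsProbabilityMeasure π]

lemma pinnedLaplace_zero (U : Finset (Fin n)) :
    pinnedLaplace π σ a T U 0 = π.real (agreeEvent σ U) := by
  rw [← integral_indicator_one (Set.toFinite _).measurableSet,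
    integral_fintype Integrable.of_finite]
  refine Finset.sum_congr rfl fun x _ => ?_
  by_cases h : ∀ i ∈ U, x i = σ i
  · rw [if_pos h, Set.indicator_of_mem (show x ∈ agreeEvent σ U from h)]
    simp
  · rw [if_neg h, Set.indicator_of_notMem (show x ∉ agreeEvent σ U from h), smul_zero]

lemma pinnedLaplace_empty (t : ℝ) :
    pinnedLaplace π σ a T ∅ t = ∫ x, Real.exp (t * agreeWeight σ a T x) ∂π := by
  rw [integral_fintype Integrable.of_finite]
  simp [pinnedLaplace]

/-- Under the measure pinned on `U`, the jumps of the mean of `∑_{j ∈ T} a_j 1[X_j = σ_j]` caused by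
one further pin, with weights `a_i θ_i`, form a value of the bilinear form of the influence
matrix. -/
lemma sum_jump_le {α c : ℝ} (hT : T.card ≤ ⌈c * n⌉₊)
    (hind : L2IndependentOn α (signSet (sparseVectors n c)) π)
    {U : Finset (Fin n)} (hU : U ⊆ T) (hpos : 0 < π.real (agreeEvent σ U))
    {θ : Fin n → ℝ} (hθ : ∀ i, 0 ≤ θ i ∧ θ i ≤ 1)
    (hθ0 : ∀ i, π.real (agreeEvent σ (insert i U)) = 0 → θ i = 0) :
    ∑ i ∈ T, a i * θ i *
      ((∑ j ∈ T, a j * π.real (agreeEvent σ (insert j (insert i U)))) /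
          π.real (agreeEvent σ (insert i U))
        - (∑ j ∈ T, a j * π.real (agreeEvent σ (insert j U))) / π.real (agreeEvent σ U)) ≤
      α * ∑ i ∈ T, a i ^ 2 := by
  have hfeas : Feasible (agreePin σ U) π := by
    rw [Feasible, pinEvent_agreePin]
    exact (ENNReal.toReal_pos_iff.1 hpos).1
  have hα := hind _ (agreePin_mem_signSet σ T hT hU) hfeas
  have hρ := pin_agreePin_real (π := π) σ U
  have : IsProbabilityMeasure (pin (agreePin σ U) π) := cond_isProbabilityMeasure hfeas.ne'
  set ρ := pin (agreePin σ U) π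
  set E := π.real (agreeEvent σ U)
  set P : Fin n → ℝ := fun i => ρ.real {x | x i = σ i} with hP
  have hP1 : ∀ i, P i ≤ 1 := fun i => measureReal_le_one
  have hP0 : ∀ i, 0 ≤ P i := fun i => measureReal_nonneg
  -- the signs of `real_inter_div_sub` go to the two vectors, the factor `1 - P i` to the second
  have key := bilin_influenceMatrix_le ρ hα
    (fun j => if j ∈ T then a j * ((σ j : ℤ) : ℝ) else 0)
    (fun i => if i ∈ T then a i * ((σ i : ℤ) : ℝ) * (θ i * (1 - P i)) else 0) (fun i => by
      split_ifs
      · rw [abs_mul]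
        refine mul_le_of_le_one_right (abs_nonneg _) ?_
        have h1 := sub_nonneg.2 (hP1 i)
        rw [abs_of_nonneg (mul_nonneg (hθ i).1 h1)]
        exact mul_le_one₀ (hθ i).2 h1 (by linarith [hP0 i])
      · simp)
  have hsq : ∑ i, (if i ∈ T then a i * ((σ i : ℤ) : ℝ) else 0) ^ 2 = ∑ i ∈ T, a i ^ 2 := by
    simp only [ite_pow, ne_eq, OfNat.ofNat_ne_zero, not_false_eq_true, zero_pow]
    rw [Finset.sum_ite_mem, Finset.univ_inter]
    refine Finset.sum_congr rfl fun i _ => ?_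
    rw [mul_pow, pow_two ((σ i : ℤ) : ℝ), Int.units_cast_mul_self, mul_one]
  rw [hsq] at key
  refine le_trans (le_of_eq ?_) key
  simp only [ite_mul, zero_mul, Finset.sum_ite_mem, Finset.univ_inter]
  refine Finset.sum_congr rfl fun i _ => ?_
  by_cases hi : π.real (agreeEvent σ (insert i U)) = 0
  · rw [hθ0 i hi]
    ring
  have hPi : P i * E = π.real (agreeEvent σ (insert i U)) := by
    rw [hP, agreeEvent_insert]
    simp only [hρ]
    exact div_mul_cancel₀ _ hpos.ne'
  have hPi0 : P i ≠ 0 := fun h => hi (by rw [← hPi, h, zero_mul])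
  have hj : ∀ j, π.real (agreeEvent σ (insert j (insert i U))) /
      π.real (agreeEvent σ (insert i U)) - π.real (agreeEvent σ (insert j U)) / E =
      ((σ j : ℤ) : ℝ) * ((σ i : ℤ) : ℝ) * (1 - P i) *
        (cov[coord j, coord i; ρ] / Var[coord i; ρ]) := fun j => by
    rw [← real_inter_div_sub ρ i j (σ i) (σ j) hPi0, hρ, hρ, hρ, agreeEvent_insert,
      agreeEvent_insert σ U i, agreeEvent_insert, Set.inter_assoc, 
      Set.inter_comm {x : SignCube n | x i = σ i} {x | x j = σ j},
      div_div_div_cancel_right₀ hpos.ne']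
  rw [Finset.sum_div, Finset.sum_div, ← Finset.sum_sub_distrib, Finset.mul_sum, Finset.mul_sum]
  refine Finset.sum_congr rfl fun j _ => ?_
  rw [mul_div_assoc, mul_div_assoc, ← mul_sub, hj]
  ring

/-- Sub-Gaussian bound for linear statistics supported on a set of at most `⌈c n⌉` coordinates. -/
theorem log_integral_exp_agreeWeight_le {α c : ℝ} (ha : ∀ i, 0 ≤ a i) (hT : T.card ≤ ⌈c * n⌉₊)
    (hind : L2IndependentOn α (signSet (sparseVectors n c)) π) {t : ℝ} (ht : 0 ≤ t) :
    Real.log (∫ x, Real.exp (t * agreeWeight σ a T x) ∂π) ≤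
      t * ∑ i ∈ T, a i * π.real {x | x i = σ i} + (α * ∑ i ∈ T, a i ^ 2) * t ^ 2 / 2 := by
  rw [← pinnedLaplace_empty]
  have h := log_le_of_hierarchy (Z := pinnedLaplace π σ a T) (T := T) (κ := α * ∑ i ∈ T, a i ^ 2) ha
    (pinnedLaplace_nonneg σ a T) (pinnedLaplace_insert_le σ a T)
    (fun U t => pinnedLaplace_eq_zero σ a T t) (fun U t => pinnedLaplace_pos σ a T t)
    (hasDerivAt_pinnedLaplace σ a T) (fun U hU h0 θ hθ hθ0 => ?_) ?_ ht
  · refine h.trans_eq ?_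
    simp only [pinnedLaplace_zero]
    simp [agreeEvent]
  · simp only [pinnedLaplace_zero] at h0 hθ0 ⊢
    exact sum_jump_le σ a T hT hind hU h0 hθ hθ0
  · rw [pinnedLaplace_zero]
    simp [agreeEvent]

end Laplace

/-! ### Averaging and relative entropy on finite spaces -/

/-- Some `m`-element subset has average at least that of the whole set. -/
lemma exists_subset_card_eq_mul_sum_le {ι : Type*} [DecidableEq ι] (f : ι → ℝ) {m : ℕ}
    (s : Finset ι) (hm : m ≤ s.card) :
    ∃ T ⊆ s, T.card = m ∧ m * ∑ i ∈ s, f i ≤ s.card * ∑ i ∈ T, f i := by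
  induction s using Finset.strongInduction with
  | H s IH =>
  rcases hm.eq_or_lt with h | h
  · exact ⟨s, le_rfl, h.symm, by rw [h]⟩
  rcases Nat.eq_zero_or_pos m with rfl | hm0
  · exact ⟨∅, Finset.empty_subset s, rfl, by simp⟩
  obtain ⟨i, hi, hmin⟩ := s.exists_min_image f (Finset.card_pos.1 (by omega))
  have hcard : (s.erase i).card + 1 = s.card := Finset.card_erase_add_one hi
  obtain ⟨T, hTs, hTm, hT⟩ := IH (s.erase i) (Finset.erase_ssubset hi) (by omega)
  refine ⟨T, hTs.trans (Finset.erase_subset i s), hTm, ?_⟩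
  have hle : s.card * f i ≤ ∑ j ∈ s, f j := by
    rw [← nsmul_eq_mul]
    exact Finset.card_nsmul_le_sum s f (f i) hmin
  have hsum := Finset.add_sum_erase s f hi
  have hc : ((s.erase i).card : ℝ) + 1 = s.card := by exact_mod_cast hcard
  have hc0 : (0 : ℝ) < (s.erase i).card := by exact_mod_cast (show 0 < (s.erase i).card by omega)
  have hm' : (0 : ℝ) ≤ m := by positivity
  refine le_of_mul_le_mul_left ?_ hc0
  have h1 : (m : ℝ) * ((s.erase i).card * ∑ j ∈ s, f j) ≤
      m * (s.card * ∑ j ∈ s.erase i, f j) := by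
    refine mul_le_mul_of_nonneg_left ?_ hm'
    rw [← hc] at hle ⊢
    nlinarith
  have h2 := mul_le_mul_of_nonneg_left hT (Nat.cast_nonneg (α := ℝ) s.card)
  nlinarith

lemma klFun_le_sq {x : ℝ} (hx : 0 ≤ x) : klFun x ≤ (x - 1) ^ 2 := by
  rcases hx.eq_or_lt with rfl | hx
  · simp [klFun_zero]
  · rw [klFun_apply]
    nlinarith [Real.log_le_sub_one_of_pos hx]

section FiniteSpace

variable {Ω : Type*} [Fintype Ω] [MeasurableSpace Ω] [DiscreteMeasurableSpace Ω]

/-- Relative entropy is at most the `χ²`-divergence. An atom of `ν`-measure `0` contributes `0` to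
the sum, which is right since `μ ≪ ν`. -/
lemma klDiv_le_sum_sq_div {μ ν : Measure Ω} [IsFiniteMeasure μ] [IsFiniteMeasure ν]
    (h : μ ≪ ν) :
    klDiv μ ν ≤ ENNReal.ofReal (∑ ω, (μ.real {ω} - ν.real {ω}) ^ 2 / ν.real {ω}) := by
  rw [klDiv_eq_integral_klFun, if_pos ⟨h, Integrable.of_finite⟩,
    integral_fintype Integrable.of_finite]
  refine ENNReal.ofReal_le_ofReal (Finset.sum_le_sum fun ω _ => ?_)
  have hrn : (μ.rnDeriv ν ω).toReal * ν.real {ω} = μ.real {ω} := by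
    have := Measure.setLIntegral_rnDeriv h {ω}
    rw [lintegral_singleton] at this
    rw [measureReal_def, measureReal_def, ← ENNReal.toReal_mul, this]
  rw [smul_eq_mul]
  refine (mul_le_mul_of_nonneg_left (klFun_le_sq ENNReal.toReal_nonneg)
    measureReal_nonneg).trans_eq ?_
  rw [← hrn]
  by_cases h0 : ν.real {ω} = 0
  · simp [h0]
  · field_simp

/-- The Gibbs variational inequality: the difference of the two sides is the relative entropy of `μ`
with respect to the tilted measure `ν.tilted f`. -/
lemma integral_sub_log_integral_exp_le_toReal_klDiv {μ ν : Measure Ω} [IsProbabilityMeasure μ]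
    [IsProbabilityMeasure ν] (h : μ ≪ ν) (f : Ω → ℝ) :
    ∫ ω, f ω ∂μ - Real.log (∫ ω, Real.exp (f ω) ∂ν) ≤ (klDiv μ ν).toReal := by
  have hexp : Integrable (fun ω => Real.exp (f ω)) ν := Integrable.of_finite
  have : IsProbabilityMeasure (ν.tilted f) := isProbabilityMeasure_tilted hexp
  have h1 := integral_llr_tilted_right h Integrable.of_finite hexp Integrable.of_finite
  have h2 := integral_llr_add_sub_measure_univ_nonneg
    (h.trans (absolutelyContinuous_tilted hexp)) Integrable.of_finite
  rw [toReal_klDiv_of_measure_eq h (by simp)]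
  simp only [probReal_univ] at h2
  linarith

end FiniteSpace

/-! ### Marginals on the slice -/

section Slice

variable {n k : ℕ}

lemma siteLaw_apply_singleton (μ : Measure (Slice n k)) (i : Fin n) :
    siteLaw μ {i} = (k : ℝ≥0∞)⁻¹ * μ {S | i ∈ S.1} := by
  simp [siteLaw, Set.indicator]

lemma siteLaw_real_singleton (μ : Measure (Slice n k)) (i : Fin n) :
    (siteLaw μ).real {i} = μ.real {S | i ∈ S.1} / k := by
  rw [measureReal_def, siteLaw_apply_singleton, ENNReal.toReal_mul, ENNReal.toReal_inv,
    ENNReal.toReal_natCast, div_eq_inv_mul, measureReal_def]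

lemma siteLaw_absolutelyContinuous {μ ν : Measure (Slice n k)} (h : μ ≪ ν) :
    siteLaw μ ≪ siteLaw ν := by
  refine Measure.AbsolutelyContinuous.mk fun s hs h0 => ?_
  rw [← Set.biUnion_of_singleton s, measure_biUnion_null_iff s.to_countable] at h0 ⊢
  intro i hi
  have := h0 i hi
  rw [siteLaw_apply_singleton] at this ⊢
  rcases mul_eq_zero.1 this with h' | h'
  · rw [h', zero_mul]
  · rw [h h', mul_zero]

lemma isFiniteMeasure_siteLaw (hk : 1 ≤ k) (μ : Measure (Slice n k)) [IsFiniteMeasure μ] :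
    IsFiniteMeasure (siteLaw μ) := by
  refine ⟨?_⟩
  have : (k : ℝ≥0∞)⁻¹ < ∞ := by simp; omega
  simp only [siteLaw, Measure.smul_apply, Measure.finsetSum_apply, smul_eq_mul]
  refine ENNReal.mul_lt_top this (ENNReal.sum_lt_top.2 fun i _ => ?_)
  simp

/-- Transport-entropy inequality for the marginals of a set of at most `⌈c n⌉` coordinates. -/
theorem sum_sq_marginal_sub_le {ν : Measure (Slice n k)} [IsProbabilityMeasure ν]
    {α c : ℝ} (hα : 0 < α)
    (hind : L2IndependentOn α (signSet (sparseVectors n c)) (ν.map sliceToCube))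
    {μ : Measure (Slice n k)} [IsProbabilityMeasure μ] (hμν : μ ≪ ν)
    {T : Finset (Fin n)} (hT : T.card ≤ ⌈c * n⌉₊) :
    ∑ i ∈ T, (μ.real {S | i ∈ S.1} - ν.real {S | i ∈ S.1}) ^ 2 ≤ 2 * α * (klDiv μ ν).toReal := by
  set d : Fin n → ℝ := fun i => μ.real {S | i ∈ S.1} - ν.real {S | i ∈ S.1} with hd
  -- test against `∑_{i ∈ T} |d i| 1[X_i = σ i]`, tilted by the optimal `t = 1 / α`
  let σ : Fin n → ℤˣ := fun i => if 0 ≤ d i then 1 else -1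
  have hmeas : Measurable (sliceToCube (n := n) (k := k)) := measurable_of_finite _
  have : IsProbabilityMeasure (ν.map sliceToCube) :=
    Measure.isProbabilityMeasure_map hmeas.aemeasurable
  have hlap := log_integral_exp_agreeWeight_le (π := ν.map sliceToCube) σ (fun i => |d i|) T
    (fun i => abs_nonneg _) hT hind (inv_nonneg.2 hα.le)
  rw [integral_map hmeas.aemeasurable (measurable_of_finite _).aestronglyMeasurable] at hlap
  have hdv := integral_sub_log_integral_exp_le_toReal_klDiv hμν
    (fun S => α⁻¹ * agreeWeight σ (fun i => |d i|) T (sliceToCube S))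
  have hagree : ∀ (ρ : Measure (Slice n k)) [IsProbabilityMeasure ρ] (i : Fin n),
      ρ.real {S | sliceToCube S i = σ i} =
        if 0 ≤ d i then ρ.real {S | i ∈ S.1} else 1 - ρ.real {S | i ∈ S.1} := fun ρ _ i => by
    split_ifs with h
    · congr 1
      ext S
      by_cases hS : i ∈ S.1 <;> simp [sliceToCube, σ, h, hS, show (-1 : ℤˣ) ≠ 1 by decide]
    · rw [← probReal_compl_eq_one_sub (Set.toFinite _).measurableSet]
      congr 1
      ext S
      by_cases hS : i ∈ S.1 <;> simp [sliceToCube, σ, h, hS, show (1 : ℤˣ) ≠ -1 by decide]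
  have hint : ∫ S, α⁻¹ * agreeWeight σ (fun i => |d i|) T (sliceToCube S) ∂μ =
      α⁻¹ * ∑ i ∈ T, |d i| * μ.real {S | sliceToCube S i = σ i} := by
    rw [integral_const_mul]
    simp only [agreeWeight]
    rw [integral_finsetSum _ fun i _ => Integrable.of_finite]
    congr 1
    refine Finset.sum_congr rfl fun i _ => ?_
    rw [integral_const_mul, ← integral_indicator_one (Set.toFinite _).measurableSet]
    congr 1
    refine integral_congr_ae (ae_of_all _ fun S => ?_)
    by_cases hS : sliceToCube S i = σ i <;> simp [Set.indicator, hS]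
  have hmap : ∀ i, (ν.map sliceToCube).real {x | x i = σ i} =
      ν.real {S | sliceToCube S i = σ i} := fun i => by
    rw [map_measureReal_apply hmeas (Set.toFinite _).measurableSet]
    rfl
  have hdiff : ∑ i ∈ T, |d i| * μ.real {S | sliceToCube S i = σ i} -
      ∑ i ∈ T, |d i| * ν.real {S | sliceToCube S i = σ i} = ∑ i ∈ T, d i ^ 2 := by
    rw [← Finset.sum_sub_distrib]
    refine Finset.sum_congr rfl fun i _ => ?_
    rw [hagree μ, hagree ν]
    split_ifs with h
    · rw [abs_of_nonneg h, ← mul_sub, pow_two]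
    · rw [abs_of_neg (not_le.1 h), ← mul_sub, hd]
      ring
  rw [hint] at hdv
  simp only [hmap, sq_abs] at hlap
  have hfin : α⁻¹ * ∑ i ∈ T, d i ^ 2 - (α * ∑ i ∈ T, d i ^ 2) * α⁻¹ ^ 2 / 2 ≤
      (klDiv μ ν).toReal := by
    rw [← hdiff] at hlap ⊢
    linarith
  have : α⁻¹ * ∑ i ∈ T, d i ^ 2 - (α * ∑ i ∈ T, d i ^ 2) * α⁻¹ ^ 2 / 2 =
      (∑ i ∈ T, d i ^ 2) / (2 * α) := by
    field_simp
    ring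
  rw [this, div_le_iff₀ (by positivity)] at hfin
  linarith

end Slice

theorem theorem1p2 (n k : ℕ) (hk : 1 ≤ k) (ν : Measure (Slice n k)) [IsProbabilityMeasure ν]
    (b α c : ℝ) (hb : b ∈ Set.Ioo (0 : ℝ) 1) (hα : 0 < α) (hc : c ∈ Set.Ioc (0 : ℝ) 1)
    (hmarg : ∀ i : Fin n, ν.real {S | i ∈ S.1} = 0 ∨ b ≤ ν.real {S | i ∈ S.1})
    (hind : L2IndependentOn α (signSet (sparseVectors n c)) (ν.map sliceToCube)) :
    EntropicallyIndependent (2 * α / (b * c)) ν := by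
  intro μ _ hμν
  have hb0 := hb.1
  have hc0 := hc.1
  have hk0 : (0 : ℝ) < k := by exact_mod_cast hk
  have hn0 : 0 < n := by
    obtain ⟨S⟩ : Nonempty (Slice n k) := nonempty_of_isProbabilityMeasure ν
    have := S.1.card_le_univ
    rw [S.2, Fintype.card_fin] at this
    omega
  have hn0' : (0 : ℝ) < n := by exact_mod_cast hn0
  have hKL : klDiv μ ν ≠ ∞ := klDiv_ne_top hμν Integrable.of_finite
  have := isFiniteMeasure_siteLaw hk μ
  have := isFiniteMeasure_siteLaw hk ν
  refine (klDiv_le_sum_sq_div (siteLaw_absolutelyContinuous hμν)).trans ?_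
  rw [← ENNReal.ofReal_toReal hKL, ← ENNReal.ofReal_mul (by positivity)]
  refine ENNReal.ofReal_le_ofReal ?_
  simp only [siteLaw_real_singleton]
  set d : Fin n → ℝ := fun i => μ.real {S | i ∈ S.1} - ν.real {S | i ∈ S.1} with hd
  have hterm : ∀ i, (μ.real {S | i ∈ S.1} / k - ν.real {S | i ∈ S.1} / k) ^ 2 /
      (ν.real {S | i ∈ S.1} / k) ≤ (b * k)⁻¹ * d i ^ 2 := fun i => by
    rcases hmarg i with h | h
    · rw [h]
      simp only [zero_div, div_zero]
      positivity
    · have hpos := hb0.trans_le h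
      have : (μ.real {S | i ∈ S.1} / k - ν.real {S | i ∈ S.1} / k) ^ 2 /
          (ν.real {S | i ∈ S.1} / k) = (ν.real {S | i ∈ S.1} * k)⁻¹ * d i ^ 2 := by
        simp only [hd]
        field_simp
      rw [this]
      gcongr
  obtain ⟨T, -, hTm, hT⟩ := exists_subset_card_eq_mul_sum_le (fun i => d i ^ 2)
    (m := ⌈c * n⌉₊) (Finset.univ : Finset (Fin n)) (by
      rw [Finset.card_univ, Fintype.card_fin, Nat.ceil_le]
      exact mul_le_of_le_one_left hn0'.le hc.2)
  rw [Finset.card_univ, Fintype.card_fin] at hT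
  have hsum : c * ∑ i, d i ^ 2 ≤ ∑ i ∈ T, d i ^ 2 := by
    refine le_of_mul_le_mul_left ?_ hn0'
    refine le_trans ?_ hT
    rw [← mul_assoc, mul_comm (n : ℝ) c]
    gcongr
    exact Nat.le_ceil _
  have hT2 := sum_sq_marginal_sub_le hα hind hμν hTm.le
  refine (Finset.sum_le_sum fun i _ => hterm i).trans ?_
  rw [← Finset.mul_sum]
  calc (b * k)⁻¹ * ∑ i, d i ^ 2 = (b * c * k)⁻¹ * (c * ∑ i, d i ^ 2) := by field_simp
    _ ≤ (b * c * k)⁻¹ * (2 * α * (klDiv μ ν).toReal) := by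
      exact mul_le_mul_of_nonneg_left (hsum.trans hT2) (by positivity)
    _ = 2 * α / (b * c) / k * (klDiv μ ν).toReal := by field_simp
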